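/- **Setting.** S-expressions are words, unsigned integers, and finite (possibly empty) lists of S-expressions; words are non-empty strings of printable non-blank ASCII characters other than parentheses that are not decimal numerals. Consider Chaitin's LISP: every word evaluates to itself, except `nil`, which evaluates to the empty list `()`; numbers and `()` evaluate to themselves; the primitives are `'` (quote), `if`, `car`, `cdr`, `cons`, `atom`, `=`, `append`, `length`, `size`, `bits`, `+ - * ^ < > <= >=`, `base2-to-10`, `base10-to-2`, `debug`, `display`, `eval` (which evaluates the value of its argument in the initial environment), `read-bit`, `read-exp` and `try`; all other functions are `(lambda (variables) body)` with dynamic scoping. An evaluation may be supplied with a finite string of raw binary data: `(read-bit)` reads the next bit, `(read-exp)` reads 8-bit ASCII characters up to and including the next newline and returns the S-expression written on that line; reading past the end of the data aborts the evaluation (*out-of-data*). `(try t e b)` evaluates $e$ in the initial environment with time limit $t$ (a bound on the nesting depth of calls, or `no-time-limit`) and with the list of bits $b$ as its binary data, and returns `(success value displays)` or `(failure out-of-time displays)` or `(failure out-of-data displays)`, where *displays* is the list of the arguments of `display` in the course of the evaluation. For an S-expression $e$ let $\mathrm{bits}(e)$ be the bit string that consists of the canonical text of $e$ (fully parenthesized,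 exactly one blank between successive elements of a list) followed by a newline character, eight bits per character. The self-delimiting universal computer $U$ is the following partial function from bit strings to S-expressions: $U(p)$ is the value of `(eval (read-exp))`, evaluated without time limit in the initial environment with binary data $p$, provided that this evaluation terminates, does not run out of data, and reads all of $p$; otherwise $U(p)$ is undefined. As a LISP function, $U$ is `(car (cdr (try no-time-limit (' (eval (read-exp))) p)))`. Put $$H(x)=\min_{U(p)=x}|p|,\qquad H(x,y)=H(\langle x,y\rangle),\qquad \langle x,y\rangle=(x\;y),$$ where $(x\;y)$ is the list with the two elements $x,y$, and call $p$ an elegant program for $x$ if $U(p)=x$ and $|p|=H(x)$. **Theorem.** Let $$\pi=\mathrm{bits}\bigl(\texttt{(cons (eval (read-exp)) (cons (eval (read-exp)) nil))}\bigr).$$ 1. $|\pi|=432$. 2. For all S-expressions $x,y$ and all elegant programs $x^*$ for $x$ and $y^*$ for $y$, $$U(\pi\,x^*\,y^*)=(x\;y)=\langle x,y\rangle ,$$ and the LISP function `(car (cdr (try no-time-limit (' (eval (read-exp))) p)))` takes the same value $(x\;y)$ at $p=\pi\,x^*\,y^*$. 3. Consequently, for all S-expressions $x,y$, $$H(x,y)\le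 H(x)+H(y)+432 .$$ -/

import Mathlib

namespace ChaitinLisp

/-! ### Characters, given by their ASCII codes -/

namespace Ascii

abbrev newline : ℕ := 10
abbrev blank : ℕ := 32
abbrev quoteMark : ℕ := 39
abbrev lparen : ℕ := 40
abbrev rparen : ℕ := 41
abbrev star : ℕ := 42
abbrev plus : ℕ := 43
abbrev hyphen : ℕ := 45
abbrev digit (n : ℕ) : ℕ := 48 + n
abbrev less : ℕ := 60
abbrev equals : ℕ := 61
abbrev greater : ℕ := 62
abbrev caret : ℕ := 94
abbrev a : ℕ := 97
abbrev b : ℕ := 98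
abbrev c : ℕ := 99
abbrev d : ℕ := 100
abbrev e : ℕ := 101
abbrev f : ℕ := 102
abbrev g : ℕ := 103
abbrev h : ℕ := 104
abbrev i : ℕ := 105
abbrev l : ℕ := 108
abbrev m : ℕ := 109
abbrev n : ℕ := 110
abbrev o : ℕ := 111
abbrev p : ℕ := 112
abbrev q : ℕ := 113
abbrev r : ℕ := 114
abbrev s : ℕ := 115
abbrev t : ℕ := 116
abbrev u : ℕ := 117
abbrev v : ℕ := 118
abbrev x : ℕ := 120
abbrev y : ℕ := 121
abbrev z : ℕ := 122

/-- A decimal digit. -/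
abbrev IsDigit (k : ℕ) : Prop := digit 0 ≤ k ∧ k ≤ digit 9

/-- A printable non-blank character other than a parenthesis. -/
abbrev IsWordChar (k : ℕ) : Prop := 33 ≤ k ∧ k ≤ 126 ∧ k ≠ lparen ∧ k ≠ rparen

end Ascii

/-! ### S-expressions -/

/-- A symbolic atom: a non-empty string of word characters that is not a decimal numeral. -/
abbrev Word : Type :=
  {w : List ℕ // w ≠ [] ∧ (∀ k ∈ w, Ascii.IsWordChar k) ∧ ¬ ∀ k ∈ w, Ascii.IsDigit k}

/-- S-expressions: words, unsigned integers and (possibly empty) lists.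
The empty list `()` counts as an atom. -/
inductive Sexp : Type
  | word : Word → Sexp
  | num : ℕ → Sexp
  | list : List Sexp → Sexp

mutual

def Sexp.decEq : (s s' : Sexp) → Decidable (s = s')
  | .word w, .word w' => decidable_of_iff (w = w') (by simp)
  | .num k, .num k' => decidable_of_iff (k = k') (by simp)
  | .list l, .list l' =>
    match Sexp.decEqList l l' with
    | isTrue h => isTrue (by rw [h])
    | isFalse h => isFalse (by simpa using h)
  | .word _, .num _ => isFalse (by simp)
  | .word _, .list _ => isFalse (by simp)
  | .num _, .word _ => isFalse (by simp)
  | .num _, .list _ => isFalse (by simp)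
  | .list _, .word _ => isFalse (by simp)
  | .list _, .num _ => isFalse (by simp)

def Sexp.decEqList : (l l' : List Sexp) → Decidable (l = l')
  | [], [] => isTrue rfl
  | [], _ :: _ => isFalse (by simp)
  | _ :: _, [] => isFalse (by simp)
  | s :: l, s' :: l' =>
    match Sexp.decEq s s', Sexp.decEqList l l' with
    | isTrue h, isTrue h' => isTrue (by rw [h, h'])
    | isFalse h, _ => isFalse (fun e => h (List.cons.inj e).1)
    | _, isFalse h => isFalse (fun e => h (List.cons.inj e).2)

end

instance : DecidableEq Sexp := Sexp.decEq

/-! ### The words that have a predefined meaning -/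

namespace Kw

section
open Ascii

def nil : Word := ⟨[n, i, l], by decide⟩
def true : Word := ⟨[t, r, u, e], by decide⟩
def false : Word := ⟨[f, a, l, s, e], by decide⟩
def success : Word := ⟨[s, u, c, c, e, s, s], by decide⟩
def failure : Word := ⟨[f, a, i, l, u, r, e], by decide⟩
def noTimeLimit : Word :=
  ⟨[n, o, hyphen, t, i, m, e, hyphen, l, i, m, i, t], by decide⟩
def outOfTime : Word := ⟨[o, u, t, hyphen, o, f, hyphen, t, i, m, e], by decide⟩
def outOfData : Word := ⟨[o, u, t, hyphen, o, f, hyphen, d, a, t, a], by decide⟩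
def quote : Word := ⟨[quoteMark], by decide⟩
def cond : Word := ⟨[i, f], by decide⟩
def display : Word := ⟨[d, i, s, p, l, a, y], by decide⟩
def readBit : Word := ⟨[r, e, a, d, hyphen, b, i, t], by decide⟩
def readExp : Word := ⟨[r, e, a, d, hyphen, e, x, p], by decide⟩
def eval : Word := ⟨[e, v, a, l], by decide⟩
def attempt : Word := ⟨[t, r, y], by decide⟩
def car : Word := ⟨[c, a, r], by decide⟩
def cdr : Word := ⟨[c, d, r], by decide⟩
def cons : Word := ⟨[c, o, n, s], by decide⟩
def atom : Word := ⟨[a, t, o, m], by decide⟩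
def eq : Word := ⟨[equals], by decide⟩
def append : Word := ⟨[a, p, p, e, n, d], by decide⟩
def length : Word := ⟨[l, e, n, g, t, h], by decide⟩
def size : Word := ⟨[s, i, z, e], by decide⟩
def bits : Word := ⟨[b, i, t, s], by decide⟩
def debug : Word := ⟨[d, e, b, u, g], by decide⟩
def add : Word := ⟨[plus], by decide⟩
def sub : Word := ⟨[hyphen], by decide⟩
def mul : Word := ⟨[star], by decide⟩
def pow : Word := ⟨[caret], by decide⟩
def lt : Word := ⟨[less], by decide⟩
def gt : Word := ⟨[greater], by decide⟩
def le : Word := ⟨[less, equals], by decide⟩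
def ge : Word := ⟨[greater, equals], by decide⟩
def base2to10 : Word :=
  ⟨[b, a, s, e, digit 2, hyphen, t, o, hyphen, digit 1, digit 0], by decide⟩
def base10to2 : Word :=
  ⟨[b, a, s, e, digit 1, digit 0, hyphen, t, o, hyphen, digit 2], by decide⟩

end

end Kw

/-! ### Printing S-expressions and converting them to bits -/

/-- The decimal numeral of `k`, without leading zeros. -/
def numeral (k : ℕ) : List ℕ :=
  if k = 0 then [Ascii.digit 0] else (Nat.digits 10 k).reverse.map Ascii.digit

mutual

/-- The canonical text of an S-expression: exactly one blank between successive elements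
of a list. -/
def Sexp.text : Sexp → List ℕ
  | .word w => w.1
  | .num k => numeral k
  | .list l => [Ascii.lparen] ++ Sexp.textElems l ++ [Ascii.rparen]

def Sexp.textElems : List Sexp → List ℕ
  | [] => []
  | [s] => Sexp.text s
  | s :: s' :: l => Sexp.text s ++ [Ascii.blank] ++ Sexp.textElems (s' :: l)

end

/-- The eight bits of a character, most significant bit first. -/
def charBits (k : ℕ) : List Bool :=
  [k.testBit 7, k.testBit 6, k.testBit 5, k.testBit 4,
   k.testBit 3, k.testBit 2, k.testBit 1, k.testBit 0]

/-- The bit string of an S-expression: its text followed by a newline, eight bits per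
character. -/
def Sexp.toBits (s : Sexp) : List Bool :=
  (s.text ++ [Ascii.newline]).flatMap charBits

/-! ### Reading S-expressions from a bit string -/

inductive Token : Type
  | lparen : Token
  | rparen : Token
  | atom : Sexp → Token

/-- The atom spelled by a string of characters; a string of digits is a number. -/
def atomOf (w : List ℕ) : Option Sexp :=
  if hw : w ≠ [] ∧ (∀ k ∈ w, Ascii.IsWordChar k) ∧ ¬ ∀ k ∈ w, Ascii.IsDigit k then
    some (.word ⟨w, hw⟩)
  else if w ≠ [] ∧ ∀ k ∈ w, Ascii.IsDigit k then
    some (.num (w.foldl (fun m k => 10 * m + (k - Ascii.digit 0)) 0))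
  else none

/-- Emit the atom (if any) spelled by the characters collected so far. -/
def flush (cur : List ℕ) (ts : List Token) : List Token :=
  match atomOf cur with
  | some s => .atom s :: ts
  | none => ts

/-- Split a line into tokens; `cur` is the part of the current atom that has been read.
Unprintable characters are skipped. -/
def tokens : List ℕ → List ℕ → List Token
  | [], cur => flush cur []
  | k :: ks, cur =>
    if k = Ascii.lparen then flush cur (.lparen :: tokens ks [])
    else if k = Ascii.rparen then flush cur (.rparen :: tokens ks [])
    else if k = Ascii.blank then flush cur (tokens ks [])
    else if Ascii.IsWordChar k then tokens ks (cur ++ [k])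
    else tokens ks cur

/-- Close all the lists that are still open. -/
def closeAll : Sexp → List (List Sexp) → Sexp
  | s, [] => s
  | s, l :: rest => closeAll (.list (l ++ [s])) rest

/-- Read the first S-expression of a list of tokens; the second argument holds the lists
that are currently open, innermost first. Missing right parentheses are supplied at the
end, anything after the first complete S-expression is ignored, and an empty line or a
line that starts with a right parenthesis reads as `()`. -/
def parse : List Token → List (List Sexp) → Sexp
  | [], [] => .list []
  | [], l :: rest => closeAll (.list l) rest
  | .atom s :: _, [] => s
  | .atom s :: ts, l :: rest => parse ts ((l ++ [s]) :: rest)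
  | .lparen :: ts, opened => parse ts ([] :: opened)
  | .rparen :: _, [] => .list []
  | .rparen :: _, [l] => .list l
  | .rparen :: ts, l :: l' :: rest => parse ts ((l' ++ [.list l]) :: rest)

/-- The S-expression on a line of text. -/
def parseLine (line : List ℕ) : Sexp := parse (tokens line []) []

/-- Read characters of eight bits up to and including the first newline. The result is the
line, without the newline, and the unread bits; it is `none` if the data runs out first. -/
def readLine : List Bool → Option (List ℕ × List Bool)
  | b7 :: b6 :: b5 :: b4 :: b3 :: b2 :: b1 :: b0 :: rest =>
    let k := Nat.ofDigits 2 ([b0, b1, b2, b3, b4, b5, b6, b7].map Bool.toNat)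
    if k = Ascii.newline then some ([], rest)
    else (readLine rest).map fun r => (k :: r.1, r.2)
  | _ => none

/-! ### Primitive functions without side effects -/

namespace Sexp

/-- The elements of a list; an atom has none. -/
def elems : Sexp → List Sexp
  | .list l => l
  | _ => []

/-- The numerical value; S-expressions that are not numbers count as 0. -/
def val : Sexp → ℕ
  | .num k => k
  | _ => 0

def ofBool (b : Bool) : Sexp := .word (if b then Kw.true else Kw.false)

/-- A bit string as a list of 0's and 1's. -/
def ofBits (l : List Bool) : Sexp := .list (l.map fun b => .num b.toNat)

/-- The bit string given by a list of 0's and 1's; every element other than 0 counts as 1. -/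
def bitList (s : Sexp) : List Bool := s.elems.map fun b => decide (b ≠ .num 0)

def isAtom : Sexp → Bool
  | .list (_ :: _) => false
  | _ => true

/-- The first element; an atom yields itself. -/
def car : Sexp → Sexp
  | .list (s :: _) => s
  | s => s

/-- All but the first element; an atom yields itself. -/
def cdr : Sexp → Sexp
  | .list (_ :: l) => .list l
  | s => s

/-- Put `s` in front of the list `s'`; the result is `s` if `s'` is not a list. -/
def cons (s : Sexp) : Sexp → Sexp
  | .list l => .list (s :: l)
  | _ => s

end Sexp

/-- The primitive functions without side effects, as functions of their first two
arguments. Subtraction on the unsigned integers is truncated at 0. -/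
def pureOps : List (Word × (Sexp → Sexp → Sexp)) :=
  [(Kw.car, fun s _ => s.car),
   (Kw.cdr, fun s _ => s.cdr),
   (Kw.cons, fun s s' => s.cons s'),
   (Kw.atom, fun s _ => .ofBool s.isAtom),
   (Kw.eq, fun s s' => .ofBool (decide (s = s'))),
   (Kw.append, fun s s' => .list (s.elems ++ s'.elems)),
   (Kw.length, fun s _ => .num s.elems.length),
   (Kw.size, fun s _ => .num s.text.length),
   (Kw.bits, fun s _ => .ofBits s.toBits),
   (Kw.debug, fun s _ => s),
   (Kw.add, fun s s' => .num (s.val + s'.val)),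
   (Kw.sub, fun s s' => .num (s.val - s'.val)),
   (Kw.mul, fun s s' => .num (s.val * s'.val)),
   (Kw.pow, fun s s' => .num (s.val ^ s'.val)),
   (Kw.lt, fun s s' => .ofBool (decide (s.val < s'.val))),
   (Kw.gt, fun s s' => .ofBool (decide (s.val > s'.val))),
   (Kw.le, fun s s' => .ofBool (decide (s.val ≤ s'.val))),
   (Kw.ge, fun s s' => .ofBool (decide (s.val ≥ s'.val))),
   (Kw.base2to10, fun s _ => .num (Nat.ofDigits 2 (s.bitList.reverse.map Bool.toNat))),
   (Kw.base10to2, fun s _ => .list ((Nat.digits 2 s.val).reverse.map .num))]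

/-- The pure primitive function named by an S-expression, if there is one. -/
def pureOp? (fn : Sexp) : Option (Sexp → Sexp → Sexp) :=
  (pureOps.find? fun o => decide (fn = .word o.1)).map Prod.snd

/-! ### The interpreter -/

/-- The two ways in which an evaluation is aborted. -/
inductive Err : Type
  | outOfTime : Err
  | outOfData : Err

def Err.toSexp : Err → Sexp
  | .outOfTime => .word Kw.outOfTime
  | .outOfData => .word Kw.outOfData

/-- The raw binary data not yet read, and the displays captured so far. -/
structure State : Type where
  tape : List Bool
  displays : List Sexp

/-- Computations that access the binary data and produce displays, and that end with a
value or are aborted; `none` stands for a computation that has not ended yet. -/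
abbrev Comp (α : Type) : Type := State → Option (Except Err α × State)

namespace Comp

def ret {α : Type} (x : α) : Comp α := fun st => some (.ok x, st)

def fail {α : Type} (er : Err) : Comp α := fun st => some (.error er, st)

def andThen {α β : Type} (m : Comp α) (k : α → Comp β) : Comp β := fun st =>
  match m st with
  | none => none
  | some (.error er, st') => some (.error er, st')
  | some (.ok x, st') => k x st'

end Comp

/-- Bindings of variables, the most recent one first. -/
abbrev Env : Type := List (Word × Sexp)

/-- Without a binding, `nil` has the value `()` and every other word has itself as value. -/
def lookup : Env → Word → Sexp
  | [], w => if w = Kw.nil then .list [] else .word w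
  | (w', s) :: env, w => if w' = w then s else lookup env w

/-- Bind the variables in a list to the arguments; missing arguments are `()`. -/
def bindVars : List Sexp → List Sexp → Env → Env
  | .word w :: vars, args, env => (w, args.headD (.list [])) :: bindVars vars args.tail env
  | _ :: vars, args, env => bindVars vars args.tail env
  | [], _, env => env

/-- Evaluate a list of expressions from left to right. -/
def evalArgs (ev : Sexp → Comp Sexp) : List Sexp → Comp (List Sexp)
  | [] => Comp.ret []
  | e :: es => (ev e).andThen fun s => (evalArgs ev es).andThen fun ss => Comp.ret (s :: ss)

def doReadBit : Comp Sexp := fun st =>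
  match st.tape with
  | [] => some (.error .outOfData, st)
  | b :: rest => some (.ok (.num b.toNat), { st with tape := rest })

def doReadExp : Comp Sexp := fun st =>
  match readLine st.tape with
  | none => some (.error .outOfData, st)
  | some (line, rest) => some (.ok (parseLine line), { st with tape := rest })

def doDisplay (s : Sexp) : Comp Sexp := fun st =>
  some (.ok s, { st with displays := st.displays ++ [s] })

/-- The time limit given by the first argument of `try`. -/
def timeLimit (s : Sexp) : WithTop ℕ := if s = .word Kw.noTimeLimit then ⊤ else (s.val : WithTop ℕ)

/-- The effect of `try`, where `body d` evaluates the given expression in time `d`.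
The expression has the list `data` as its binary data and its displays are captured; the
state outside is not touched. If the enclosing computation has no more time left than the
limit of this `try`, then running out of time aborts the enclosing computation as well. -/
def doTry (remaining limit : WithTop ℕ) (data : Sexp) (body : WithTop ℕ → Comp Sexp) : Comp Sexp := fun st =>
  match body (min remaining limit) { tape := data.bitList, displays := [] } with
  | none => none
  | some (.ok s, st') =>
    some (.ok (.list [.word Kw.success, s, .list st'.displays]), st)
  | some (.error .outOfTime, st') =>
    if remaining ≤ limit then some (.error .outOfTime, st)
    else some (.ok (.list [.word Kw.failure, Err.toSexp .outOfTime, .list st'.displays]), st)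
  | some (.error .outOfData, st') =>
    some (.ok (.list [.word Kw.failure, Err.toSexp .outOfData, .list st'.displays]), st)

/-- Apply the function `fn` to the argument values `args`. Here `ev d env e` evaluates `e`
in time `d`. Time is measured by the depth of nested calls of `eval`, `try` and defined
functions. A function that is not primitive is `(lambda (variables...) body)`; its free
variables get the values that they have at the point of call. Missing arguments are `()`,
superfluous ones are ignored. -/
def applyFn (ev : WithTop ℕ → Env → Sexp → Comp Sexp) (d : WithTop ℕ) (env : Env) (fn : Sexp)
    (args : List Sexp) : Comp Sexp :=
  let arg (j : ℕ) : Sexp := args.getD j (.list [])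
  match pureOp? fn with
  | some op => Comp.ret (op (arg 0) (arg 1))
  | none =>
    if fn = .word Kw.display then doDisplay (arg 0)
    else if fn = .word Kw.readBit then doReadBit
    else if fn = .word Kw.readExp then doReadExp
    else if d = 0 then Comp.fail .outOfTime
    else if fn = .word Kw.eval then ev (d - 1) [] (arg 0)
    else if fn = .word Kw.attempt then
      doTry (d - 1) (timeLimit (arg 0)) (arg 2) fun d' => ev d' [] (arg 1)
    else ev (d - 1) (bindVars fn.cdr.car.elems args env) fn.cdr.cdr.car

/-- The interpreter. The expression `e` is evaluated in the environment `env` with time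
limit `d`. The first argument bounds the recursion depth of the interpreter itself; the
result is `none` exactly if this bound is too small. -/
def evalN : ℕ → WithTop ℕ → Env → Sexp → Comp Sexp
  | 0, _, _, _ => fun _ => none
  | _ + 1, _, env, .word w => Comp.ret (lookup env w)
  | _ + 1, _, _, .num k => Comp.ret (.num k)
  | _ + 1, _, _, .list [] => Comp.ret (.list [])
  | n + 1, d, env, .list (e :: es) =>
    (evalN n d env e).andThen fun fn =>
      if fn = .word Kw.quote then Comp.ret (es.headD (.list []))
      else if fn = .word Kw.cond then
        (evalN n d env (es.headD (.list []))).andThen fun s =>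
          evalN n d env (es.getD (if s = .word Kw.false then 2 else 1) (.list []))
      else
        (evalArgs (evalN n d env) es).andThen fun args =>
          applyFn (evalN n) d env fn args

/-- The outcome of the evaluation of `e`, without time limit and in the environment
without bindings, with `p` as binary data; undefined if the evaluation does not end. -/
def outcome (e : Sexp) (p : List Bool) : Part (Except Err Sexp × State) :=
  Nat.rfindOpt fun n => evalN n ⊤ [] e { tape := p, displays := [] }

/-! ### The universal computer and program-size complexity -/

/-- The expression `(eval (read-exp))`. -/
def evalReadExp : Sexp := .list [.word Kw.eval, .list [.word Kw.readExp]]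

/-- The self-delimiting universal computer: `(eval (read-exp))` is tried on the binary
data `p` without time limit. `U p` is defined, and is the value obtained, if the evaluation
ends without running out of data and has read `p` up to its end. Thus no extension of a
program on which `U` is defined is another such program. -/
def U : List Bool →. Sexp := fun p =>
  (outcome evalReadExp p).bind fun r =>
    match r with
    | (.ok s, { tape := [], displays := _ }) => Part.some s
    | _ => Part.none

/-- The universal computer as a LISP function: the value of
`(car (cdr (try no-time-limit (' (eval (read-exp))) (' p))))`, where `p` is given as a list
of 0's and 1's. -/
def lispU : List Bool →. Sexp := fun p =>
  (outcome
      (.list [.word Kw.car, .list [.word Kw.cdr,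
        .list [.word Kw.attempt, .word Kw.noTimeLimit,
          .list [.word Kw.quote, evalReadExp],
          .list [.word Kw.quote, Sexp.ofBits p]]]]) []).bind fun r =>
    match r with
    | (.ok s, _) => Part.some s
    | _ => Part.none

/-- The size in bits of the smallest program for `s`; it is `⊤` if there is none. -/
noncomputable def H (s : Sexp) : ℕ∞ := ⨅ (p : List Bool) (_ : s ∈ U p), (p.length : ℕ∞)

/-- The pair of two S-expressions, as a list with two elements. -/
def pair (s s' : Sexp) : Sexp := .list [s, s']

/-- The joint complexity: the size of the smallest program for the pair. -/
noncomputable def jointH (s s' : Sexp) : ℕ∞ := H (pair s s')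

/-- `p` is an elegant program for `s`: it computes `s` and is as small as possible. -/
def IsElegant (p : List Bool) (s : Sexp) : Prop := s ∈ U p ∧ (p.length : ℕ∞) = H s

/-- The expression `cons eval read-exp cons eval read-exp nil` with its parentheses supplied:
`(cons (eval (read-exp)) (cons (eval (read-exp)) nil))`. -/
def pairingExp : Sexp :=
  .list [.word Kw.cons, evalReadExp, .list [.word Kw.cons, evalReadExp, .word Kw.nil]]

/-- The prefix for the universal computer that is given by `pairingExp`. -/
def pairingPrefix : List Bool := pairingExp.toBits

end ChaitinLisp

/-! Started on `pairingPrefix ++ p ++ q`, the universal computer reads `pairingExp` and evaluates it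
on the data `p ++ q`. Each of the two subexpressions `(eval (read-exp))` of `pairingExp` is the
expression that defines `U` itself. A run of `U` on `p` reads `p` exactly up to its end, and bits
that are never read cannot influence a successful run; so the first subexpression has the value
`U p` and leaves `q` to the second, whose run in turn does not depend on the displays made before.
The constant is `8 * (53 + 1)`: the text of `pairingExp` has 53 characters. -/

namespace ChaitinLisp

/-! ### Monotonicity in the recursion depth -/

/-- Computations are ordered by definedness: a larger one has all the results of a smaller one. -/
instance (α : Type) : Preorder (Comp α) where
  le m m' := ∀ st r, m st = some r → m' st = some r
  le_refl _ _ _ h := h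
  le_trans _ _ _ h h' st r hr := h' st r (h st r hr)

theorem Comp.andThen_mono {α β : Type} {m m' : Comp α} {k k' : α → Comp β} (hm : m ≤ m')
    (hk : k ≤ k') : m.andThen k ≤ m'.andThen k' := by
  intro st r h
  unfold Comp.andThen at h ⊢
  rcases hst : m st with _ | ⟨er | x, st'⟩
  · simp [hst] at h
  · simpa [hst, hm _ _ hst] using h
  · simp only [hst] at h
    simpa only [hm _ _ hst] using hk x _ _ h

theorem evalArgs_mono : Monotone evalArgs := by
  intro ev ev' h es
  induction es with
  | nil => exact le_rfl
  | cons e es ih => exact Comp.andThen_mono (h e) fun _ => Comp.andThen_mono ih fun _ => le_rfl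

theorem doTry_mono (remaining limit : WithTop ℕ) (data : Sexp) :
    Monotone (doTry remaining limit data) := by
  intro body body' h st r hr
  unfold doTry at hr ⊢
  rcases hb : body (min remaining limit) ⟨data.bitList, []⟩ with _ | r'
  · simp [hb] at hr
  · rw [h _ _ _ hb]
    rwa [hb] at hr

theorem applyFn_mono : Monotone applyFn := by
  intro ev ev' h d env fn args
  unfold applyFn
  dsimp only
  split
  · exact le_rfl
  · split_ifs
    any_goals exact le_rfl
    · exact h _ _ _
    · exact doTry_mono _ _ _ fun _ => h _ _ _
    · exact h _ _ _

/-- The evaluation of a call whose function part has the value `fn` and whose remaining elements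
are `es`; here `ev d env e` evaluates `e` in time `d`. -/
def evalCall (ev : WithTop ℕ → Env → Sexp → Comp Sexp) (d : WithTop ℕ) (env : Env)
    (es : List Sexp) (fn : Sexp) : Comp Sexp :=
  if fn = .word Kw.quote then Comp.ret (es.headD (.list []))
  else if fn = .word Kw.cond then
    (ev d env (es.headD (.list []))).andThen fun s =>
      ev d env (es.getD (if s = .word Kw.false then 2 else 1) (.list []))
  else (evalArgs (ev d env) es).andThen (applyFn ev d env fn)

theorem evalN_succ_cons (n : ℕ) (d : WithTop ℕ) (env : Env) (e : Sexp) (es : List Sexp) :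
    evalN (n + 1) d env (.list (e :: es)) =
      (evalN n d env e).andThen (evalCall (evalN n) d env es) :=
  rfl

theorem evalCall_mono : Monotone evalCall := by
  intro ev ev' h d env es fn
  unfold evalCall
  split_ifs
  · exact le_rfl
  · exact Comp.andThen_mono (h _ _ _) fun _ => h _ _ _
  · exact Comp.andThen_mono (evalArgs_mono (h d env) es) (applyFn_mono h d env fn)

theorem evalN_mono : Monotone evalN := by
  refine monotone_nat_of_le_succ fun n => ?_
  induction n with
  | zero => intro d env e st r h; simp [evalN] at h
  | succ n ih =>
    intro d env e
    match e with
    | .word _ | .num _ | .list [] => exact le_rfl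
    | .list (_ :: es) =>
      rw [evalN_succ_cons n, evalN_succ_cons (n + 1)]
      exact Comp.andThen_mono (ih _ _ _) (evalCall_mono ih d env es)

theorem mem_outcome {e : Sexp} {p : List Bool} {r : Except Err Sexp × State} :
    r ∈ outcome e p ↔ ∃ n, evalN n ⊤ [] e ⟨p, []⟩ = some r :=
  Nat.rfindOpt_mono fun hmn => evalN_mono hmn _ _ _ _ _

/-! ### Locality -/

/-- The state `st` with `t` appended to the unread data and `ds` put before the displays: the larger
context in which a run started from `st` can be repeated. -/
def State.extend (st : State) (t : List Bool) (ds : List Sexp) : State :=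
  ⟨st.tape ++ t, ds ++ st.displays⟩

/-- A computation is local if its successful runs depend neither on data that they leave unread
nor on earlier displays. Aborted runs are exempt, since additional data can prevent them from
running out of data. -/
def Comp.IsLocal {α : Type} (m : Comp α) : Prop :=
  ∀ ⦃st x st'⦄, m st = some (.ok x, st') →
    ∀ t ds, m (st.extend t ds) = some (.ok x, st'.extend t ds)

theorem Comp.isLocal_ret {α : Type} (x : α) : (Comp.ret x).IsLocal := by
  rintro st _ _ ⟨⟩ t ds
  rfl

theorem Comp.isLocal_fail {α : Type} (er : Err) : (Comp.fail er : Comp α).IsLocal := by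
  rintro st _ _ ⟨⟩

theorem Comp.IsLocal.andThen {α β : Type} {m : Comp α} {k : α → Comp β} (hm : m.IsLocal)
    (hk : ∀ x, (k x).IsLocal) : (m.andThen k).IsLocal := by
  intro st y st' h t ds
  unfold Comp.andThen at h ⊢
  rcases hst : m st with _ | ⟨er | x, st₁⟩
  · simp [hst] at h
  · simp [hst] at h
  · simp only [hst] at h
    simpa only [hm hst t ds] using hk x h t ds

theorem isLocal_evalArgs {ev : Sexp → Comp Sexp} (h : ∀ e, (ev e).IsLocal) (es : List Sexp) :
    (evalArgs ev es).IsLocal := by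
  induction es with
  | nil => exact Comp.isLocal_ret _
  | cons e es ih => exact (h e).andThen fun _ => ih.andThen fun _ => Comp.isLocal_ret _

theorem isLocal_doDisplay (s : Sexp) : (doDisplay s).IsLocal := by
  rintro st _ _ ⟨⟩ t ds
  simp [doDisplay, State.extend]

theorem isLocal_doReadBit : doReadBit.IsLocal := by
  rintro ⟨_ | ⟨b, p⟩, ds'⟩ _ _ ⟨⟩ t ds
  rfl

theorem readLine_append {p rest : List Bool} {line : List ℕ} (h : readLine p = some (line, rest))
    (t : List Bool) : readLine (p ++ t) = some (line, rest ++ t) := by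
  fun_induction readLine p generalizing line rest with
  | case1 _ _ _ _ _ _ _ _ p k =>
    rename_i hk
    obtain ⟨rfl, rfl⟩ := h
    simp only [List.cons_append]
    rw [readLine, if_pos hk]
  | case2 _ _ _ _ _ _ _ _ p k =>
    rename_i hk ih
    obtain ⟨⟨line', rest'⟩, h', ⟨⟩⟩ := Option.map_eq_some_iff.1 h
    simp only [List.cons_append]
    rw [readLine, if_neg hk, ih h', Option.map_some]
  | case3 => cases h

theorem isLocal_doReadExp : doReadExp.IsLocal := by
  intro st x st' h t ds
  unfold doReadExp at h ⊢
  rcases hl : readLine st.tape with _ | ⟨line, rest⟩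
  · simp [hl] at h
  · simp only [hl] at h
    cases h
    simp [State.extend, readLine_append hl]

theorem isLocal_doTry (remaining limit : WithTop ℕ) (data : Sexp)
    (body : WithTop ℕ → Comp Sexp) : (doTry remaining limit data body).IsLocal := by
  intro st x st' h t ds
  unfold doTry at h ⊢
  generalize body (min remaining limit) ⟨data.bitList, []⟩ = result at h ⊢
  rcases result with _ | ⟨(_ | _) | s, st₁⟩
  · cases h
  · dsimp only at h ⊢
    split_ifs at h ⊢ <;> cases h
    rfl
  all_goals
    cases h
    rfl

theorem isLocal_applyFn {ev : WithTop ℕ → Env → Sexp → Comp Sexp}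
    (h : ∀ d env e, (ev d env e).IsLocal) (d : WithTop ℕ) (env : Env) (fn : Sexp)
    (args : List Sexp) : (applyFn ev d env fn args).IsLocal := by
  unfold applyFn
  dsimp only
  split
  · exact Comp.isLocal_ret _
  · split_ifs
    · exact isLocal_doDisplay _
    · exact isLocal_doReadBit
    · exact isLocal_doReadExp
    · exact Comp.isLocal_fail _
    · exact h _ _ _
    · exact isLocal_doTry _ _ _ _
    · exact h _ _ _

theorem isLocal_evalCall {ev : WithTop ℕ → Env → Sexp → Comp Sexp}
    (h : ∀ d env e, (ev d env e).IsLocal) (d : WithTop ℕ) (env : Env) (es : List Sexp)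
    (fn : Sexp) : (evalCall ev d env es fn).IsLocal := by
  unfold evalCall
  split_ifs
  · exact Comp.isLocal_ret _
  · exact (h _ _ _).andThen fun _ => h _ _ _
  · exact (isLocal_evalArgs (h d env) es).andThen fun _ => isLocal_applyFn h _ _ _ _

theorem isLocal_evalN (n : ℕ) (d : WithTop ℕ) (env : Env) (e : Sexp) :
    (evalN n d env e).IsLocal := by
  induction n generalizing d env e with
  | zero => rintro st _ _ ⟨⟩
  | succ n ih =>
    match e with
    | .word _ | .num _ | .list [] => exact Comp.isLocal_ret _
    | .list (_ :: _) =>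
      rw [evalN_succ_cons]
      exact (ih _ _ _).andThen (isLocal_evalCall ih _ _ _)

/-! ### Big-step semantics -/

section

variable {e e' fn s : Sexp} {es args : List Sexp} {st st₁ st₂ st₃ : State}

/-- For a sequence `m` of computations with increasing recursion depth: some `m n` leads from the
state `st` to the value `x` and the state `st'`. -/
def Returns {α : Type} (m : ℕ → Comp α) (st : State) (x : α) (st' : State) : Prop :=
  ∃ n, m n st = some (.ok x, st')

theorem Returns.of_succ {α : Type} {m : ℕ → Comp α} {x : α}
    (h : Returns (fun n => m (n + 1)) st x st₁) : Returns m st x st₁ :=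
  let ⟨n, hn⟩ := h
  ⟨n + 1, hn⟩

theorem Returns.andThen {α β : Type} {m : ℕ → Comp α} {k : ℕ → α → Comp β} {x : α} {y : β}
    (hm : Monotone m) (hk : Monotone k) (h : Returns m st x st₁)
    (h' : Returns (fun n => k n x) st₁ y st₂) :
    Returns (fun n => (m n).andThen (k n)) st y st₂ := by
  obtain ⟨n, hn⟩ := h
  obtain ⟨n', hn'⟩ := h'
  refine ⟨max n n', ?_⟩
  simp only [Comp.andThen, hm (le_max_left n n') _ _ hn]
  exact hk (le_max_right n n') _ _ _ hn'

/-- The evaluation of `e` without time limit in the initial environment leads from the state `st`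
to the value `s` and the state `st'`. -/
def Evaluates (e : Sexp) (st : State) (s : Sexp) (st' : State) : Prop :=
  Returns (fun n => evalN n ⊤ [] e) st s st'

/-- The evaluation of the expressions `es` from left to right, without time limit in the initial
environment, leads from the state `st` to the values `ss` and the state `st'`. -/
def EvaluatesArgs (es : List Sexp) (st : State) (ss : List Sexp) (st' : State) : Prop :=
  Returns (fun n => evalArgs (evalN n ⊤ []) es) st ss st'

/-- The application of the function `fn` to the values `args`, without time limit in the initial
environment, leads from the state `st` to the value `s` and the state `st'`. -/
def Applies (fn : Sexp) (args : List Sexp) (st : State) (s : Sexp) (st' : State) : Prop :=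
  Returns (fun n => applyFn (evalN n) ⊤ [] fn args) st s st'

theorem Evaluates.extend (h : Evaluates e st s st₁) (t : List Bool) (ds : List Sexp) :
    Evaluates e (st.extend t ds) s (st₁.extend t ds) :=
  h.imp fun n hn => isLocal_evalN n _ _ _ hn t ds

theorem EvaluatesArgs.nil : EvaluatesArgs [] st [] st := ⟨0, rfl⟩

theorem EvaluatesArgs.cons (h : Evaluates e st s st₁) (h' : EvaluatesArgs es st₁ args st₂) :
    EvaluatesArgs (e :: es) st (s :: args) st₂ := by
  refine Returns.andThen (fun _ _ hn => evalN_mono hn _ _ _) (fun _ _ hn _ => ?_) h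
    (Returns.andThen (fun _ _ hn => ?_) monotone_const h' ⟨0, rfl⟩)
  · exact Comp.andThen_mono (evalArgs_mono (evalN_mono hn _ _) es) le_rfl
  · exact evalArgs_mono (evalN_mono hn _ _) es

theorem Evaluates.word {w : Word} (hw : w ≠ Kw.nil) : Evaluates (.word w) st (.word w) st :=
  ⟨1, by simp only [evalN, Comp.ret, lookup, if_neg hw]⟩

theorem Evaluates.nil : Evaluates (.word Kw.nil) st (.list []) st := ⟨1, rfl⟩

theorem Evaluates.quote : Evaluates (.list [.word Kw.quote, s]) st s st := ⟨2, rfl⟩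

theorem Evaluates.call (h : Evaluates e st fn st₁) (hquote : fn ≠ .word Kw.quote)
    (hcond : fn ≠ .word Kw.cond) (hes : EvaluatesArgs es st₁ args st₂)
    (hfn : Applies fn args st₂ s st₃) : Evaluates (.list (e :: es)) st s st₃ := by
  have apply_fn : Returns (fun n => evalCall (evalN n) ⊤ [] es fn) st₁ s st₃ := by
    simp only [evalCall, if_neg hquote, if_neg hcond]
    exact Returns.andThen (fun _ _ hn => evalArgs_mono (evalN_mono hn _ _) _)
      (fun _ _ hn => applyFn_mono (evalN_mono hn) _ _ _) hes hfn
  refine Returns.of_succ ?_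
  simp only [evalN_succ_cons]
  exact Returns.andThen (fun _ _ hn => evalN_mono hn _ _ _)
    (fun _ _ hn => evalCall_mono (evalN_mono hn) _ _ _) h apply_fn

theorem Evaluates.wordCall {w : Word} (hw : w ∉ [Kw.nil, Kw.quote, Kw.cond])
    (hes : EvaluatesArgs es st args st₁) (hfn : Applies (.word w) args st₁ s st₂) :
    Evaluates (.list (.word w :: es)) st s st₂ := by
  simp only [List.mem_cons, List.not_mem_nil, or_false, not_or] at hw
  obtain ⟨hnil, hquote, hcond⟩ := hw
  exact .call (.word hnil) (by simpa using hquote) (by simpa using hcond) hes hfn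

theorem Applies.pureOp {op : Sexp → Sexp → Sexp} (hop : pureOp? fn = some op) :
    Applies fn args st (op (args.getD 0 (.list [])) (args.getD 1 (.list []))) st :=
  ⟨0, by simp only [applyFn, hop, Comp.ret]⟩

theorem Applies.readExp {p rest : List Bool} {line : List ℕ} {ds : List Sexp}
    (h : readLine p = some (line, rest)) :
    Applies (.word Kw.readExp) args ⟨p, ds⟩ (parseLine line) ⟨rest, ds⟩ := by
  have apply_eq (n : ℕ) : applyFn (evalN n) ⊤ [] (.word Kw.readExp) args = doReadExp := rfl
  exact ⟨0, by simp only [apply_eq, doReadExp, h]⟩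

theorem Applies.eval (h : Evaluates e st s st₁) : Applies (.word Kw.eval) [e] st s st₁ := h

theorem Applies.attempt {data : Sexp} (h : Evaluates e ⟨data.bitList, []⟩ s st₁) :
    Applies (.word Kw.attempt) [.word Kw.noTimeLimit, e, data] st
      (.list [.word Kw.success, s, .list st₁.displays]) st := by
  obtain ⟨n, hn⟩ := h
  have apply_eq : applyFn (evalN n) ⊤ [] (.word Kw.attempt) [.word Kw.noTimeLimit, e, data] =
      doTry ⊤ ⊤ data fun d => evalN n d [] e := rfl
  exact ⟨n, by simp only [apply_eq, doTry, min_self, hn]⟩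

theorem Evaluates.consPair {x y : Sexp} (hx : Evaluates e st x st₁) (hy : Evaluates e' st₁ y st₂) :
    Evaluates (.list [.word Kw.cons, e, .list [.word Kw.cons, e', .word Kw.nil]]) st
      (pair x y) st₂ := by
  have singleton : Evaluates (.list [.word Kw.cons, e', .word Kw.nil]) st₁ (.list [y]) st₂ :=
    .wordCall (by decide) (.cons hy (.cons .nil .nil)) (.pureOp (op := fun s s' => s.cons s') rfl)
  exact .wordCall (by decide) (.cons hx (.cons singleton .nil))
    (.pureOp (op := fun s s' => s.cons s') rfl)

end

/-! ### The universal computer -/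

section

variable {s x y : Sexp} {p q : List Bool}

theorem mem_U : s ∈ U p ↔ ∃ ds, Evaluates evalReadExp ⟨p, []⟩ s ⟨[], ds⟩ := by
  unfold U
  rw [Part.mem_bind_iff]
  constructor
  · rintro ⟨⟨er | s', ⟨_ | ⟨b, t⟩, ds⟩⟩, hr, hs⟩
    · simp at hs
    · simp at hs
    · obtain rfl : s = s' := by simpa using hs
      exact ⟨ds, mem_outcome.1 hr⟩
    · simp at hs
  · rintro ⟨ds, h⟩
    exact ⟨_, mem_outcome.2 h, Part.mem_some _⟩

theorem mem_U_append_of_readLine {line : List ℕ} {ds : List Sexp}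
    (hp : readLine p = some (line, [])) (h : Evaluates (parseLine line) ⟨q, []⟩ s ⟨[], ds⟩) :
    s ∈ U (p ++ q) :=
  have readExp : Evaluates (.list [.word Kw.readExp]) ⟨p ++ q, []⟩ (parseLine line) ⟨q, []⟩ :=
    .wordCall (by decide) .nil (.readExp (readLine_append hp q))
  mem_U.2 ⟨ds, .wordCall (by decide) (.cons readExp .nil) (.eval h)⟩

theorem bitList_ofBits (p : List Bool) : (Sexp.ofBits p).bitList = p := by
  simp [Sexp.ofBits, Sexp.bitList, Sexp.elems, Function.comp_def]

theorem mem_lispU_of_evaluates {st : State} (h : Evaluates evalReadExp ⟨p, []⟩ s st) :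
    s ∈ lispU p := by
  rw [← bitList_ofBits p] at h
  have tried : Evaluates (.list [.word Kw.attempt, .word Kw.noTimeLimit,
      .list [.word Kw.quote, evalReadExp], .list [.word Kw.quote, Sexp.ofBits p]]) ⟨[], []⟩
      (.list [.word Kw.success, s, .list st.displays]) ⟨[], []⟩ :=
    .wordCall (by decide) (.cons (.word (by decide)) (.cons .quote (.cons .quote .nil)))
      (.attempt h)
  have rest := Evaluates.wordCall (w := Kw.cdr) (by decide) (.cons tried .nil) (.pureOp rfl)
  have value := Evaluates.wordCall (w := Kw.car) (by decide) (.cons rest .nil) (.pureOp rfl)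
  rw [lispU, Part.mem_bind_iff]
  exact ⟨_, mem_outcome.2 value, Part.mem_some s⟩

theorem mem_lispU_of_mem_U (h : s ∈ U p) : s ∈ lispU p :=
  let ⟨_, h⟩ := mem_U.1 h
  mem_lispU_of_evaluates h

theorem length_toBits (s : Sexp) : s.toBits.length = 8 * (s.text.length + 1) := by
  simp [Sexp.toBits, charBits, mul_comm, mul_add]

theorem length_pairingPrefix : pairingPrefix.length = 432 :=
  length_toBits pairingExp

theorem readLine_pairingPrefix : readLine pairingPrefix = some (pairingExp.text, []) :=
  rfl

theorem parseLine_text_pairingExp : parseLine pairingExp.text = pairingExp :=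
  rfl

theorem pair_mem_U (hx : x ∈ U p) (hy : y ∈ U q) : pair x y ∈ U (pairingPrefix ++ p ++ q) := by
  obtain ⟨ds, hx⟩ := mem_U.1 hx
  obtain ⟨ds', hy⟩ := mem_U.1 hy
  have first : Evaluates evalReadExp ⟨p ++ q, []⟩ x ⟨q, ds⟩ := by
    simpa [State.extend] using hx.extend q []
  have second : Evaluates evalReadExp ⟨q, ds⟩ y ⟨[], ds ++ ds'⟩ := by
    simpa [State.extend] using hy.extend [] ds
  rw [List.append_assoc]
  refine mem_U_append_of_readLine (ds := ds ++ ds') readLine_pairingPrefix ?_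
  rw [parseLine_text_pairingExp]
  exact first.consPair second

theorem H_le_length (h : s ∈ U p) : H s ≤ p.length := iInf₂_le p h

theorem H_le_H_add_H_add_length {c : List Bool}
    (h : ∀ p q, x ∈ U p → y ∈ U q → s ∈ U (c ++ p ++ q)) : H s ≤ H x + H y + c.length := by
  have bound (p q : List Bool) (hp : x ∈ U p) (hq : y ∈ U q) :
      H s ≤ (p.length : ℕ∞) + q.length + c.length :=
    calc H s ≤ (c ++ p ++ q).length := H_le_length (h p q hp hq)
      _ = (p.length : ℕ∞) + q.length + c.length := by
        simp only [List.length_append]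
        push_cast
        ring
  conv_rhs => simp only [H, ENat.iInf_add, ENat.add_iInf]
  exact le_iInf₂ fun q hq => le_iInf₂ fun p hp => bound p q hp hq

end

end ChaitinLisp

open ChaitinLisp in
theorem mainTheorem5_general :
    pairingPrefix.length = 432 ∧
    (∀ (x y : Sexp) (p q : List Bool), x ∈ U p → y ∈ U q →
      U (pairingPrefix ++ p ++ q) = Part.some (pair x y) ∧
      lispU (pairingPrefix ++ p ++ q) = Part.some (pair x y)) ∧
    (∀ x y : Sexp, jointH x y ≤ H x + H y + 432) := by
  refine ⟨length_pairingPrefix, fun x y p q hx hy => ?_, fun x y => ?_⟩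
  · have hxy : pair x y ∈ U (pairingPrefix ++ p ++ q) := pair_mem_U hx hy
    exact ⟨Part.eq_some_iff.2 hxy, Part.eq_some_iff.2 (mem_lispU_of_mem_U hxy)⟩
  · calc jointH x y ≤ H x + H y + pairingPrefix.length :=
          H_le_H_add_H_add_length fun p q => pair_mem_U
      _ = H x + H y + 432 := by rw [length_pairingPrefix, Nat.cast_ofNat]

open ChaitinLisp in
theorem mainTheorem5 :
    pairingPrefix.length = 432 ∧
    (∀ (x y : Sexp) (xStar yStar : List Bool), IsElegant xStar x → IsElegant yStar y →
      U (pairingPrefix ++ xStar ++ yStar) = Part.some (pair x y) ∧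
      lispU (pairingPrefix ++ xStar ++ yStar) = Part.some (pair x y)) ∧
    (∀ x y : Sexp, jointH x y ≤ H x + H y + 432) :=
  let ⟨hlength, hpair, hH⟩ := mainTheorem5_general
  ⟨hlength, fun x y p q hp hq => hpair x y p q hp.1 hq.1, hH⟩
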